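/- Let $X$ be a (real or complex) Banach space. For a free ultrafilter $\mathcal U$ on $\mathbb N$ let $X^{\mathcal U}$ be the quotient of $\ell_\infty(X)$ by $\{(x_n)_n\in\ell_\infty(X):\lim_{\mathcal U}x_n=0\}$, and for $A\subseteq X$ let $A^{\mathcal U}$ be the set of those elements of $X^{\mathcal U}$ that have a representative $(x_n)_n\in\ell_\infty(X)$ with $x_n\in A$ for all $n\in\mathbb N$. The set $A$ is called relatively super weakly compact if $A^{\mathcal U}$ is relatively weakly compact in $X^{\mathcal U}$ for every free ultrafilter $\mathcal U$ on $\mathbb N$, and super weakly compact if it is relatively super weakly compact and weakly closed. It is called weakly precompact if every sequence in $A$ has a weakly Cauchy subsequence, where a sequence $(x_n)_n$ in $X$ is weakly Cauchy if $(x^*(x_n))_n$ converges for every $x^*\in X^*$. Then the following are equivalent: 1. $X$ has property (R), that is, every weakly precompact subset of $X$ is relatively super weakly compact; 2. every weakly compact subset of $X$ is super weakly compact. -/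

import Mathlib

open Filter Topology
open scoped ENNReal

namespace SuperWeak

section Weak

variable (𝕜 : Type*) [RCLike 𝕜] {E : Type*} [AddCommGroup E] [Module 𝕜 E] [TopologicalSpace E]

/-- `A` is compact for the weak topology of `E`. -/
def IsWeaklyCompact (A : Set E) : Prop :=
  IsCompact (toWeakSpace 𝕜 E '' A)

/-- `A` is closed for the weak topology of `E`. -/
def IsWeaklyClosed (A : Set E) : Prop :=
  IsClosed (toWeakSpace 𝕜 E '' A)

/-- The closure of `A` for the weak topology of `E` is compact for the weak topology. -/
def IsRelativelyWeaklyCompact (A : Set E) : Prop :=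
  IsCompact (closure (toWeakSpace 𝕜 E '' A))

/-- The sequence `x` is weakly Cauchy: every continuous linear functional sends it to a convergent
sequence of scalars. -/
def IsWeaklyCauchy (x : ℕ → E) : Prop :=
  ∀ f : StrongDual 𝕜 E, ∃ l : 𝕜, Tendsto (fun n => f (x n)) atTop (𝓝 l)

/-- Every sequence in `A` has a weakly Cauchy subsequence. -/
def IsWeaklyPrecompact (A : Set E) : Prop :=
  ∀ x : ℕ → E, (∀ n, x n ∈ A) → ∃ φ : ℕ → ℕ, StrictMono φ ∧ IsWeaklyCauchy 𝕜 (x ∘ φ)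

end Weak

section Ultrapower

variable (𝕜 : Type*) [RCLike 𝕜] (X : Type*) [NormedAddCommGroup X] [NormedSpace 𝕜 X]

/-- The space `N_U` of the bounded sequences in `X` that tend to zero along `U`. -/
def nullSubmodule (U : Ultrafilter ℕ) : Submodule 𝕜 (lp (fun _ : ℕ => X) ∞) where
  carrier := {x | Tendsto (fun n => x n) (U : Filter ℕ) (𝓝 0)}
  zero_mem' :=
    (tendsto_const_nhds : Tendsto (fun _ : ℕ => (0 : X)) (U : Filter ℕ) (𝓝 0))
  add_mem' {x y} hx hy := by
    have h := Tendsto.add (x := (U : Filter ℕ)) hx hy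
    rw [add_zero] at h
    exact h
  smul_mem' c x hx := by
    have h := Tendsto.const_smul (l := (U : Filter ℕ)) hx c
    rw [smul_zero] at h
    exact h

/-- The ultrapower `X^U`: the quotient of `ℓ_∞(X)` by `N_U`, with the quotient norm. -/
abbrev Ultrapower (U : Ultrafilter ℕ) : Type _ :=
  lp (fun _ : ℕ => X) ∞ ⧸ nullSubmodule 𝕜 X U

variable {X}

/-- The set `A^U` of the elements of `X^U` that have a representative with all its terms in `A`. -/
def ultrapowerSet (U : Ultrafilter ℕ) (A : Set X) : Set (Ultrapower 𝕜 X U) :=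
  {z | ∃ x : lp (fun _ : ℕ => X) ∞, (∀ n, x n ∈ A) ∧ (nullSubmodule 𝕜 X U).mkQ x = z}

/-- `A^U` is relatively weakly compact in `X^U` for every free ultrafilter `U` on `ℕ`. -/
def IsRelativelySuperWeaklyCompact (A : Set X) : Prop :=
  ∀ U : Ultrafilter ℕ, (U : Filter ℕ) ≤ cofinite →
    IsRelativelyWeaklyCompact 𝕜 (ultrapowerSet 𝕜 U A)

/-- `A` is relatively super weakly compact and weakly closed. -/
def IsSuperWeaklyCompact (A : Set X) : Prop :=
  IsRelativelySuperWeaklyCompact 𝕜 A ∧ IsWeaklyClosed 𝕜 A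

variable (X)

/-- Property (R): every weakly precompact subset of `X` is relatively super weakly compact. -/
def PropertyR : Prop :=
  ∀ A : Set X, IsWeaklyPrecompact 𝕜 A → IsRelativelySuperWeaklyCompact 𝕜 A

end Ultrapower

end SuperWeak

namespace SuperWeak

/-! ### Weak topology: boundedness and sequential compactness. -/

section Weak

variable {𝕜 : Type*} [RCLike 𝕜] {X : Type*} [NormedAddCommGroup X] [NormedSpace 𝕜 X]

/-! (1) ⇒ (2) holds because weakly compact sets are weakly precompact (Eberlein–Šmulian). For (2) ⇒
(1), a relatively weakly compact `A` inherits the conclusion from its weak closure. Otherwise James'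
argument (`exists_isConvexlySeparated`) gives a convexly separated sequence in `A`, and a
subsequence is weakly Cauchy. Its differences in `differenceSet` are weakly null, so with 0 they
form a weakly compact set. Yet its ultrapower contains a copy of the separated sequence, translated
by one element; by Mazur such a sequence has no weak cluster point, contradicting (2). -/

theorem tendsto_toWeakSpace_iff {ι : Type*} {l : Filter ι} {x : ι → X} {a : X} :
    Tendsto (fun i => toWeakSpace 𝕜 X (x i)) l (𝓝 (toWeakSpace 𝕜 X a)) ↔
      ∀ f : StrongDual 𝕜 X, Tendsto (fun i => f (x i)) l (𝓝 (f a)) :=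
  WeakBilin.tendsto_iff_forall_eval_tendsto (B := (topDualPairing 𝕜 X).flip) fun _ _ h => by
    by_contra hne
    obtain ⟨f, hf⟩ := SeparatingDual.exists_separating_of_ne (R := 𝕜) hne
    exact hf (DFunLike.congr_fun h f)

theorem continuous_weakSpace_eval (f : StrongDual 𝕜 X) :
    Continuous fun v : WeakSpace 𝕜 X => f ((toWeakSpace 𝕜 X).symm v) :=
  WeakBilin.eval_continuous (topDualPairing 𝕜 X).flip f

theorem IsWeaklyCompact.isWeaklyClosed {K : Set X} (hK : IsWeaklyCompact 𝕜 K) :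
    IsWeaklyClosed 𝕜 K :=
  have := (NormedSpace.isEmbedding_inclusionInDoubleDualWeak 𝕜 X).t2Space
  IsCompact.isClosed hK

theorem IsWeaklyCauchy.exists_norm_le {x : ℕ → X} (hx : IsWeaklyCauchy 𝕜 x) :
    ∃ C, ∀ n, ‖x n‖ ≤ C := by
  obtain ⟨C, hC⟩ := banach_steinhaus
    (g := fun n => NormedSpace.inclusionInDoubleDual 𝕜 X (x n)) fun f => by
      obtain ⟨l, hl⟩ := hx f
      obtain ⟨C, hC⟩ := (Metric.isBounded_range_of_tendsto _ hl).exists_norm_le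
      exact ⟨C, fun n => hC _ ⟨n, rfl⟩⟩
  exact ⟨C, fun n => ((NormedSpace.inclusionInDoubleDualLi 𝕜 (E := X)).norm_map (x n)).symm.trans_le
    (hC n)⟩

theorem IsWeaklyPrecompact.isBounded {A : Set X} (hA : IsWeaklyPrecompact 𝕜 A) :
    Bornology.IsBounded A := by
  by_contra h
  have h' : ∀ n : ℕ, ∃ a ∈ A, (n : ℝ) < ‖a‖ := by
    intro n
    by_contra! hn
    exact h (isBounded_iff_forall_norm_le.2 ⟨n, hn⟩)
  choose x hxA hx using h'
  obtain ⟨φ, hφ, hc⟩ := hA x hxA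
  obtain ⟨C, hC⟩ := hc.exists_norm_le
  obtain ⟨n, hn⟩ := exists_nat_gt C
  have h1 : (n : ℝ) ≤ φ n := by exact_mod_cast hφ.id_le n
  have := hx (φ n)
  have := hC n
  simp only [Function.comp_apply] at this
  linarith

variable (𝕜) in
/-- On a separable subspace, countably many functionals separate points. -/
theorem exists_seq_dual_separating (Y : Submodule 𝕜 X) [TopologicalSpace.SeparableSpace Y] :
    ∃ f : ℕ → StrongDual 𝕜 X, ∀ y ∈ Y, (∀ n, f n y = 0) → y = 0 := by
  choose f hf1 hf using fun n => exists_dual_vector'' 𝕜 (TopologicalSpace.denseSeq Y n : X)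
  refine ⟨f, fun y hy h0 => ?_⟩
  by_contra hne
  have hpos : 0 < ‖y‖ := norm_pos_iff.2 hne
  obtain ⟨n, hn⟩ := (TopologicalSpace.denseRange_denseSeq Y).exists_dist_lt ⟨y, hy⟩
    (half_pos hpos)
  set d : X := ((TopologicalSpace.denseSeq Y n : Y) : X)
  have hn' : ‖y - d‖ < ‖y‖ / 2 := by
    rw [← dist_eq_norm]; exact hn
  -- `f n` norms `d` and kills `y`, so `d` is as small as `y - d`.
  have h1 : ‖d‖ = ‖f n (y - d)‖ := by
    rw [map_sub, h0 n, hf n, zero_sub, norm_neg]; simp [d]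
  have h2 : ‖f n (y - d)‖ ≤ ‖y - d‖ := by
    simpa using (f n).le_of_opNorm_le (hf1 n) (y - d)
  have h3 : ‖y‖ ≤ ‖y - d‖ + ‖d‖ := norm_le_norm_sub_add y d
  linarith

/-- The sequence lives in a separable closed subspace, where countably many functionals separate
points and so metrize the weak topology on compact sets. -/
theorem IsWeaklyCompact.isWeaklyPrecompact {K : Set X} (hK : IsWeaklyCompact 𝕜 K) :
    IsWeaklyPrecompact 𝕜 K := by
  let : NormedSpace ℝ X := NormedSpace.restrictScalars ℝ 𝕜 X
  have : IsScalarTower ℝ 𝕜 X := IsScalarTower.of_algebraMap_smul fun _ _ => rfl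
  intro x hx
  set Y : Submodule 𝕜 X := (Submodule.span 𝕜 (Set.range x)).topologicalClosure
  have hxY : ∀ n, x n ∈ Y := fun n =>
    Submodule.le_topologicalClosure _ (Submodule.subset_span ⟨n, rfl⟩)
  have hsep : TopologicalSpace.IsSeparable (Y : Set X) := by
    rw [Submodule.topologicalClosure_coe]
    exact ((Set.countable_range x).isSeparable.span (R := 𝕜)).closure
  have : TopologicalSpace.SeparableSpace Y := hsep.separableSpace
  obtain ⟨f, hf⟩ := exists_seq_dual_separating 𝕜 Y
  have hYc : IsClosed (toWeakSpace 𝕜 X '' (Y : Set X)) := by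
    have hconv : Convex ℝ (Y : Set X) := (Y.restrictScalars ℝ).convex
    have hcl : IsClosed (Y : Set X) := Submodule.isClosed_topologicalClosure _
    rw [← hcl.closure_eq, hconv.toWeakSpace_closure 𝕜]
    exact isClosed_closure
  set C := toWeakSpace 𝕜 X '' K ∩ toWeakSpace 𝕜 X '' (Y : Set X)
  have hC : IsCompact C := IsCompact.inter_right hK hYc
  have : CompactSpace C := isCompact_iff_compactSpace.1 hC
  have hmet : TopologicalSpace.MetrizableSpace C := by
    refine Metric.PiNatEmbed.TopologicalSpace.MetrizableSpace.of_countable_separating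
      (fun n (c : C) => f n ((toWeakSpace 𝕜 X).symm c))
      (fun n => (continuous_weakSpace_eval (f n)).comp continuous_subtype_val) ?_
    rintro ⟨_, _, a, ha, rfl⟩ ⟨_, _, b, hb, rfl⟩ hab
    contrapose! hab with h
    refine Subtype.ext ?_
    have := hf (a - b) (Y.sub_mem ha hb) fun n => by
      rw [map_sub, sub_eq_zero]; simpa using h n
    rw [sub_eq_zero] at this
    simp [this]
  let := TopologicalSpace.metrizableSpaceMetric C
  obtain ⟨c, φ, hφ, hc⟩ := CompactSpace.tendsto_subseq
    (fun n => (⟨toWeakSpace 𝕜 X (x n), ⟨x n, hx n, rfl⟩, ⟨x n, hxY n, rfl⟩⟩ : C))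
  refine ⟨φ, hφ, fun g => ⟨g ((toWeakSpace 𝕜 X).symm c), ?_⟩⟩
  exact ((continuous_weakSpace_eval g).comp continuous_subtype_val).continuousAt.tendsto.comp hc

end Weak

/-! ### Convexly separated sequences. -/

section ConvexSeparation

variable {X : Type*} [NormedAddCommGroup X] [NormedSpace ℝ X]

/-- The convex hulls of the initial segments of the sequence `x` have distance at least `δ` from
the convex hulls of the corresponding tails. -/
def IsConvexlySeparated (δ : ℝ) (x : ℕ → X) : Prop :=
  ∀ k, ∀ y ∈ convexHull ℝ (x '' Set.Iic k), ∀ w ∈ convexHull ℝ (x '' Set.Ioi k), δ ≤ ‖w - y‖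

theorem IsConvexlySeparated.comp {δ : ℝ} {x : ℕ → X} (hx : IsConvexlySeparated δ x) {φ : ℕ → ℕ}
    (hφ : StrictMono φ) : IsConvexlySeparated δ (x ∘ φ) := by
  intro k y hy w hw
  refine hx (φ k) y (convexHull_mono ?_ hy) w (convexHull_mono ?_ hw)
  · rintro _ ⟨i, hi, rfl⟩
    exact ⟨φ i, hφ.monotone hi, rfl⟩
  · rintro _ ⟨i, hi, rfl⟩
    exact ⟨φ i, hφ hi, rfl⟩

end ConvexSeparation

/-! ### James' construction in the bidual. -/

section James

variable {𝕜 : Type*} [RCLike 𝕜] {X : Type*} [NormedAddCommGroup X] [NormedSpace 𝕜 X]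

theorem exists_re_apply_gt_of_lt_norm {E : Type*} [NormedAddCommGroup E] [NormedSpace 𝕜 E]
    (φ : StrongDual 𝕜 E) {r : ℝ} (hr : r < ‖φ‖) : ∃ v : E, ‖v‖ ≤ 1 ∧ r < RCLike.re (φ v) := by
  obtain ⟨v, hv, hrv⟩ := φ.exists_lt_apply_of_lt_opNorm hr
  obtain ⟨c, hc, hcv⟩ := RCLike.exists_norm_eq_mul_self (φ v)
  refine ⟨c • v, by rw [norm_smul, hc, one_mul]; exact hv.le, ?_⟩
  rw [map_smul, smul_eq_mul, ← hcv, RCLike.ofReal_re]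
  exact hrv

/-- If `F` has distance at least `d` from `X` in the bidual, then finitely many functionals
witness this, up to a factor, on a compact set. -/
theorem exists_finset_dual_of_isCompact {F : StrongDual 𝕜 (StrongDual 𝕜 X)} {d : ℝ} (hd : 0 < d)
    (hF : ∀ y, d ≤ ‖F - NormedSpace.inclusionInDoubleDual 𝕜 X y‖) {C : Set X} (hC : IsCompact C) :
    ∃ T : Finset (StrongDual 𝕜 X), (∀ f ∈ T, ‖f‖ ≤ 1) ∧
      ∀ y ∈ C, ∃ f ∈ T, d / 2 < RCLike.re (F f - f y) := by
  classical
  refine hC.induction_on (p := fun C => ∃ T : Finset (StrongDual 𝕜 X), (∀ f ∈ T, ‖f‖ ≤ 1) ∧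
      ∀ y ∈ C, ∃ f ∈ T, d / 2 < RCLike.re (F f - f y)) ⟨∅, by simp, by simp⟩ ?_ ?_ ?_
  · rintro s t hst ⟨T, h1, h2⟩
    exact ⟨T, h1, fun y hy => h2 y (hst hy)⟩
  · rintro s t ⟨S, hS1, hS2⟩ ⟨T, hT1, hT2⟩
    refine ⟨S ∪ T, fun f hf => (Finset.mem_union.1 hf).elim (hS1 f) (hT1 f), ?_⟩
    rintro y (hy | hy)
    · obtain ⟨f, hf, h⟩ := hS2 y hy
      exact ⟨f, Finset.mem_union_left _ hf, h⟩
    · obtain ⟨f, hf, h⟩ := hT2 y hy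
      exact ⟨f, Finset.mem_union_right _ hf, h⟩
  · intro y _
    obtain ⟨f, hf1, hf⟩ := exists_re_apply_gt_of_lt_norm _ ((half_lt_self hd).trans_le (hF y))
    refine ⟨{v | d / 2 < RCLike.re (F f - f v)}, mem_nhdsWithin_of_mem_nhds ?_, {f}, by simpa,
      by simp⟩
    exact (isOpen_lt continuous_const (by fun_prop)).mem_nhds hf

/-- A bounded set that is not relatively weakly compact contains a convexly separated sequence. -/
theorem exists_isConvexlySeparated [NormedSpace ℝ X] [IsScalarTower ℝ 𝕜 X] [CompleteSpace X]
    {A : Set X} (hA : Bornology.IsBounded A) (hAc : ¬ IsRelativelyWeaklyCompact 𝕜 A) :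
    ∃ x : ℕ → X, (∀ n, x n ∈ A) ∧ ∃ δ > 0, IsConvexlySeparated δ x := by
  classical
  have h := mt (NormedSpace.isCompact_closure_of_isBounded 𝕜 X (toWeakSpace 𝕜 X '' A)
    (by rwa [Set.preimage_image_eq _ (toWeakSpace 𝕜 X).injective])) hAc
  obtain ⟨ξ, hξ, hξX⟩ := Set.not_subset.1 h
  set F : StrongDual 𝕜 (StrongDual 𝕜 X) := WeakDual.toStrongDual ξ
  have hFX : F ∉ Set.range (NormedSpace.inclusionInDoubleDualLi 𝕜 (E := X)) := by
    rintro ⟨y, hy⟩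
    refine hξX ⟨toWeakSpace 𝕜 X y, ?_⟩
    exact DFunLike.ext _ _ fun f => DFunLike.congr_fun hy f
  -- Completeness makes `X` closed in its bidual, so `F` has positive distance from it.
  have hcl : IsClosed (Set.range (NormedSpace.inclusionInDoubleDualLi 𝕜 (E := X))) :=
    (NormedSpace.inclusionInDoubleDualLi 𝕜 (E := X)).isometry.isUniformInducing.isComplete_range.isClosed
  obtain ⟨d, hd, hball⟩ := Metric.isOpen_iff.1 hcl.isOpen_compl F hFX
  have hF : ∀ y, d ≤ ‖F - NormedSpace.inclusionInDoubleDual 𝕜 X y‖ := by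
    intro y
    by_contra! hlt
    refine hball (a := NormedSpace.inclusionInDoubleDual 𝕜 X y) ?_ ⟨y, rfl⟩
    have hdist := dist_eq_norm F (NormedSpace.inclusionInDoubleDual 𝕜 X y)
    exact Metric.mem_ball'.2 (hdist.trans_lt hlt)
  have happrox : ∀ T : Finset (StrongDual 𝕜 X),
      ∃ a ∈ A, ∀ f ∈ T, RCLike.re (F f - f a) < d / 4 := by
    intro T
    let V : Set (WeakDual 𝕜 (StrongDual 𝕜 X)) :=
      ⋂ f ∈ T, {η | RCLike.re (F f - η f) < d / 4}
    have hV : IsOpen V := isOpen_biInter_finset fun f _ =>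
      isOpen_lt (RCLike.continuous_re.comp
        (continuous_const.sub (WeakDual.eval_continuous f))) continuous_const
    have hmem : ξ ∈ V := by
      refine Set.mem_iInter₂.2 fun f _ => ?_
      have : F f - ξ f = 0 := sub_self _
      simp only [Set.mem_ofPred_eq, this, map_zero]
      positivity
    obtain ⟨_, hη, _, ⟨a, ha, rfl⟩, rfl⟩ := mem_closure_iff.1 hξ V hV hmem
    exact ⟨a, ha, fun f hf => Set.mem_iInter₂.1 hη f hf⟩
  let good : Finset X → Finset (StrongDual 𝕜 X) → Prop := fun S T =>
    (∀ f ∈ T, ‖f‖ ≤ 1) ∧ ∀ y ∈ convexHull ℝ (S : Set X), ∃ f ∈ T, d / 2 < RCLike.re (F f - f y)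
  -- A term holds a point, the finite set of points so far, and functionals keeping `F` more than `d
  -- / 2` away from the hull of that set. Later points agree with `F` on these functionals up to `d
  -- / 4`, which leaves the gap `d / 2 - d / 4`.
  obtain ⟨s, hs, hr⟩ := exists_seq_of_forall_finset_exists
    (α := X × Finset X × Finset (StrongDual 𝕜 X))
    (fun p => p.1 ∈ A ∧ p.1 ∈ p.2.1 ∧ good p.2.1 p.2.2)
    (fun p q => p.2.1 ⊆ q.2.1 ∧ ∀ f ∈ p.2.2, RCLike.re (F f - f q.1) < d / 4) (by
      intro s _
      obtain ⟨a, ha, haT⟩ := happrox (s.biUnion fun p => p.2.2)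
      let S : Finset X := insert a (s.biUnion fun p => p.2.1)
      obtain ⟨T, hT⟩ := exists_finset_dual_of_isCompact hd hF
        (S.finite_toSet.isCompact_convexHull (𝕜 := ℝ))
      refine ⟨(a, S, T), ⟨ha, Finset.mem_insert_self _ _, hT⟩, fun p hp => ⟨?_, fun f hf => ?_⟩⟩
      · exact (Finset.subset_biUnion_of_mem (fun p => p.2.1) hp).trans (Finset.subset_insert _ _)
      · exact haT f (Finset.mem_biUnion.2 ⟨p, hp, hf⟩))
  refine ⟨fun n => (s n).1, fun n => (hs n).1, d / 4, by positivity, fun k y hy w hw => ?_⟩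
  have hyS : y ∈ convexHull ℝ ((s k).2.1 : Set X) := by
    refine convexHull_mono ?_ hy
    rintro _ ⟨i, hi, rfl⟩
    rcases (Set.mem_Iic.1 hi).eq_or_lt with rfl | hlt
    · exact (hs i).2.1
    · exact (hr i k hlt).1 (hs i).2.1
  obtain ⟨f, hfT, hf⟩ := (hs k).2.2.2 y hyS
  have hwf : RCLike.re (F f) - d / 4 < RCLike.re (f w) := by
    have hconv : Convex ℝ {v : X | RCLike.re (F f) - d / 4 < RCLike.re (f v)} :=
      convex_halfSpace_gt (f := fun v => RCLike.re (f v))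
        ((RCLike.reLm (K := 𝕜)).comp (f.toLinearMap.restrictScalars ℝ)).isLinear _
    refine convexHull_min ?_ hconv hw
    rintro _ ⟨i, hi, rfl⟩
    have := (hr k i hi).2 f hfT
    rw [map_sub] at this
    simp only [Set.mem_ofPred_eq]
    linarith
  have h1 : RCLike.re (f (w - y)) ≤ ‖w - y‖ :=
    (RCLike.re_le_norm _).trans (by simpa using f.le_of_opNorm_le ((hs k).2.2.1 f hfT) (w - y))
  rw [map_sub, map_sub] at h1
  rw [map_sub] at hf
  linarith

end James

/-! ### Ultrapowers, and Mazur's theorem at weak cluster points. -/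

section Ultrapower

variable {𝕜 : Type*} [RCLike 𝕜] {X : Type*} [NormedAddCommGroup X] [NormedSpace 𝕜 X]

theorem ultrapowerSet_mono (U : Ultrafilter ℕ) {A B : Set X} (h : A ⊆ B) :
    ultrapowerSet 𝕜 U A ⊆ ultrapowerSet 𝕜 U B := by
  rintro z ⟨x, hx, rfl⟩
  exact ⟨x, fun n => h (hx n), rfl⟩

theorem IsRelativelySuperWeaklyCompact.mono {A B : Set X}
    (hB : IsRelativelySuperWeaklyCompact 𝕜 B) (h : A ⊆ B) :
    IsRelativelySuperWeaklyCompact 𝕜 A := fun U hU =>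
  (hB U hU).of_isClosed_subset isClosed_closure
    (closure_mono (Set.image_mono (ultrapowerSet_mono U h)))

theorem eventually_norm_lt_of_norm_mkQ_lt {U : Ultrafilter ℕ} {v : lp (fun _ : ℕ => X) ∞} {ε : ℝ}
    (hv : ‖(nullSubmodule 𝕜 X U).mkQ v‖ < ε) : ∀ᶠ n in (U : Filter ℕ), ‖v n‖ < ε := by
  obtain ⟨m, hm, hmε⟩ := QuotientAddGroup.norm_lt_iff.1 hv
  have hnull : Tendsto (fun n => (v - m) n) (U : Filter ℕ) (𝓝 0) :=
    (Submodule.Quotient.eq _).1 (show (nullSubmodule 𝕜 X U).mkQ v = Submodule.Quotient.mk m from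
      hm.symm)
  filter_upwards [Metric.tendsto_nhds.1 hnull _ (sub_pos.2 hmε)] with n hn
  have h1 : ‖v n - m n‖ < ε - ‖m‖ := by simpa using hn
  have h2 : ‖m n‖ ≤ ‖m‖ := lp.norm_apply_le_norm ENNReal.top_ne_zero m n
  linarith [norm_le_norm_sub_add (v n) (m n)]

/-- A weak cluster point of a sequence is a norm limit of convex combinations of its initial
segments and of its tails. -/
theorem exists_convexHull_norm_sub_lt {E : Type*} [SeminormedAddCommGroup E] [NormedSpace 𝕜 E]
    [NormedSpace ℝ E] [IsScalarTower ℝ 𝕜 E] {A : Set E} (hA : IsRelativelyWeaklyCompact 𝕜 A)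
    {z : ℕ → E} (hz : ∀ i, z i ∈ A) {ε : ℝ} (hε : 0 < ε) :
    ∃ k, ∃ y ∈ convexHull ℝ (z '' Set.Iic k), ∃ w ∈ convexHull ℝ (z '' Set.Ioi k),
      ‖w - y‖ < ε := by
  obtain ⟨ζ, -, hζ⟩ := hA.exists_clusterPt (f := map (fun i => toWeakSpace 𝕜 E (z i)) atTop)
    (le_principal_iff.2 (mem_map.2 (Eventually.of_forall fun i =>
      subset_closure ⟨z i, hz i, rfl⟩)))
  obtain ⟨a, rfl⟩ := (toWeakSpace 𝕜 E).surjective ζ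
  -- Mazur: weak and norm closures of a convex hull coincide.
  have key : ∀ s ∈ (atTop : Filter ℕ), ∃ y ∈ convexHull ℝ (z '' s), dist a y < ε / 2 := by
    intro s hs
    have h1 : toWeakSpace 𝕜 E a ∈ closure (toWeakSpace 𝕜 E '' convexHull ℝ (z '' s)) := by
      refine mem_closure_iff_clusterPt.2 (hζ.mono (le_principal_iff.2 (mem_map.2 ?_)))
      filter_upwards [hs] with i hi
      exact ⟨z i, subset_convexHull ℝ _ ⟨i, hi, rfl⟩, rfl⟩
    rw [← (convex_convexHull ℝ _).toWeakSpace_closure 𝕜,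
      (toWeakSpace 𝕜 E).injective.mem_set_image] at h1
    exact Metric.mem_closure_iff.1 h1 _ (half_pos hε)
  obtain ⟨y, hy, hay⟩ := key _ univ_mem
  -- A convex combination uses finitely many terms; this fixes `k` before the tail is chosen.
  have hyk : y ∈ ⋃ k, convexHull ℝ (z '' Set.Iic k) := by
    have hmono : Monotone fun k => convexHull ℝ (z '' Set.Iic k) := fun i j hij =>
      convexHull_mono (Set.image_mono (Set.Iic_subset_Iic.2 hij))
    refine convexHull_min ?_ (hmono.directed_le.convex_iUnion fun k => convex_convexHull ℝ _) hy
    rintro _ ⟨i, -, rfl⟩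
    exact Set.mem_iUnion.2 ⟨i, subset_convexHull ℝ _ ⟨i, Set.self_mem_Iic, rfl⟩⟩
  obtain ⟨k, hk⟩ := Set.mem_iUnion.1 hyk
  obtain ⟨w, hw, haw⟩ := key _ (Ioi_mem_atTop k)
  refine ⟨k, y, hk, w, hw, ?_⟩
  rw [← dist_eq_norm]
  linarith [dist_triangle_left w y a]

/-- The evaluation of bounded sequences at `n`, as a real-linear map. -/
def lpEval [NormedSpace ℝ X] (n : ℕ) : lp (fun _ : ℕ => X) ∞ →ₗ[ℝ] X where
  toFun x := x n
  map_add' _ _ := rfl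
  map_smul' _ _ := rfl

end Ultrapower

/-! ### The difference set of a weakly Cauchy sequence. -/

section Differences

variable {𝕜 : Type*} [RCLike 𝕜] {X : Type*} [NormedAddCommGroup X] [NormedSpace 𝕜 X]

/-- The differences `x (n + i) - x n` with `i ≤ n`, together with zero. -/
def differenceSet (x : ℕ → X) : Set X :=
  insert 0 (Set.range fun p : {p : ℕ × ℕ // p.2 ≤ p.1} => x (p.1.1 + p.1.2) - x p.1.1)

/-- The bound `i ≤ n` leaves finitely many pairs for each `n`, so both indices tend to infinity
along `cofinite` and the differences tend weakly to 0. -/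
theorem IsWeaklyCauchy.isWeaklyCompact_differenceSet {x : ℕ → X} (hx : IsWeaklyCauchy 𝕜 x) :
    IsWeaklyCompact 𝕜 (differenceSet x) := by
  have h1 : Tendsto (fun p : {p : ℕ × ℕ // p.2 ≤ p.1} => p.1.1) cofinite atTop := by
    rw [← Nat.cofinite_eq_atTop]
    refine Tendsto.cofinite_of_finite_preimage_singleton fun n => ?_
    refine Set.Finite.of_finite_image (f := Subtype.val)
      (((Set.finite_Iic n).prod (Set.finite_Iic n)).subset ?_) Subtype.val_injective.injOn
    rintro _ ⟨⟨p, hp⟩, h, rfl⟩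
    have h' : p.1 = n := h
    exact ⟨h'.le, hp.trans h'.le⟩
  have h2 : Tendsto (fun p : {p : ℕ × ℕ // p.2 ≤ p.1} => p.1.1 + p.1.2) cofinite atTop :=
    tendsto_atTop_mono (fun p => Nat.le_add_right _ _) h1
  have h : Tendsto (fun p : {p : ℕ × ℕ // p.2 ≤ p.1} =>
      toWeakSpace 𝕜 X (x (p.1.1 + p.1.2) - x p.1.1)) cofinite (𝓝 (toWeakSpace 𝕜 X 0)) := by
    refine tendsto_toWeakSpace_iff.2 fun f => ?_
    obtain ⟨l, hl⟩ := hx f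
    simpa using (hl.comp h2).sub (hl.comp h1)
  have := h.isCompact_insert_range_of_cofinite
  rwa [IsWeaklyCompact, differenceSet, Set.image_insert_eq, ← Set.range_comp]

theorem IsConvexlySeparated.not_isRelativelySuperWeaklyCompact_differenceSet [NormedSpace ℝ X]
    [IsScalarTower ℝ 𝕜 X] {x : ℕ → X} {δ : ℝ} (hδ : 0 < δ) (hx : IsConvexlySeparated δ x) {C : ℝ}
    (hC : ∀ n, ‖x n‖ ≤ C) : ¬ IsRelativelySuperWeaklyCompact 𝕜 (differenceSet x) := by
  intro h
  let U : Ultrafilter ℕ := hyperfilter ℕ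
  have hU : (U : Filter ℕ) ≤ cofinite := hyperfilter_le_cofinite
  -- The truncation `min i n` keeps every coordinate in `differenceSet x`; it changes nothing once
  -- `n ≥ i`.
  let b : ℕ → lp (fun _ : ℕ => X) ∞ := fun i =>
    ⟨fun n => x (n + min i n) - x n, memℓp_infty ⟨C + C, by
      rintro _ ⟨n, rfl⟩
      exact (norm_sub_le _ _).trans (add_le_add (hC _) (hC _))⟩⟩
  let Q : lp (fun _ : ℕ => X) ∞ →ₗ[ℝ] Ultrapower 𝕜 X U :=
    (nullSubmodule 𝕜 X U).mkQ.restrictScalars ℝ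
  obtain ⟨k, y, hy, w, hw, hwy⟩ := exists_convexHull_norm_sub_lt (h U hU) (z := fun i => Q (b i))
    (fun i => ⟨b i, fun n => Set.mem_insert_of_mem _ ⟨⟨(n, min i n), min_le_right _ _⟩, rfl⟩, rfl⟩)
    hδ
  have himage : ∀ s : Set ℕ, (fun i => Q (b i)) '' s = Q '' (b '' s) := fun s =>
    (Set.image_image _ _ _).symm
  rw [himage, ← LinearMap.image_convexHull] at hy hw
  obtain ⟨y, hy, rfl⟩ := hy
  obtain ⟨w, hw, rfl⟩ := hw
  rw [← map_sub] at hwy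
  -- Weights sum to 1, so adding `x n` undoes the subtraction; this shift cancels in `w - y`.
  have hev : ∀ n, ∀ s : Set ℕ, ∀ v ∈ convexHull ℝ (b '' s),
      x n + v n ∈ convexHull ℝ ((fun i => x (n + min i n)) '' s) := by
    intro n s v hv
    refine convexHull_min ?_ (((convex_convexHull ℝ _).translate_preimage_right (x n)).linear_preimage
      (lpEval n)) hv
    rintro _ ⟨i, hi, rfl⟩
    refine subset_convexHull ℝ _ ⟨i, hi, ?_⟩
    exact (add_sub_cancel (x n) (x (n + min i n))).symm
  have hn : ∀ᶠ n in (U : Filter ℕ), k < n :=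
    (Nat.cofinite_eq_atTop ▸ hU) (eventually_gt_atTop k)
  obtain ⟨n, hn, hkn⟩ := ((eventually_norm_lt_of_norm_mkQ_lt hwy).and hn).exists
  -- As `k < n`, truncation keeps every index `i > k` above `k`, so `n + k` separates the two hulls.
  have := hx (n + k) _ (convexHull_mono ?_ (hev n _ y hy)) _ (convexHull_mono ?_ (hev n _ w hw))
  · rw [add_sub_add_left_eq_sub] at this
    exact this.not_gt hn
  · rintro _ ⟨i, hi, rfl⟩
    exact ⟨_, Nat.add_le_add_left ((min_le_left _ _).trans hi) n, rfl⟩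
  · rintro _ ⟨i, hi, rfl⟩
    exact ⟨_, Nat.add_lt_add_left (lt_min hi hkn) n, rfl⟩

end Differences

end SuperWeak

theorem mainTheorem2 {𝕜 : Type*} [RCLike 𝕜] {X : Type*} [NormedAddCommGroup X] [NormedSpace 𝕜 X]
    [CompleteSpace X] :
    SuperWeak.PropertyR 𝕜 X ↔
      ∀ K : Set X, SuperWeak.IsWeaklyCompact 𝕜 K → SuperWeak.IsSuperWeaklyCompact 𝕜 K := by
  let : NormedSpace ℝ X := NormedSpace.restrictScalars ℝ 𝕜 X
  have : IsScalarTower ℝ 𝕜 X := IsScalarTower.of_algebraMap_smul fun _ _ => rfl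
  refine ⟨fun h K hK => ⟨h K hK.isWeaklyPrecompact, hK.isWeaklyClosed⟩, fun h A hA => ?_⟩
  by_cases hc : SuperWeak.IsRelativelyWeaklyCompact 𝕜 A
  · let K : Set X := toWeakSpace 𝕜 X ⁻¹' closure (toWeakSpace 𝕜 X '' A)
    have hK : SuperWeak.IsWeaklyCompact 𝕜 K := by
      rwa [SuperWeak.IsWeaklyCompact, Set.image_preimage_eq _ (toWeakSpace 𝕜 X).surjective]
    exact (h K hK).1.mono fun a ha =>
      Set.mem_preimage.2 (subset_closure (Set.mem_image_of_mem _ ha))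
  · obtain ⟨x, hxA, δ, hδ, hx⟩ := SuperWeak.exists_isConvexlySeparated hA.isBounded hc
    obtain ⟨φ, hφ, hcauchy⟩ := hA x hxA
    obtain ⟨C, hC⟩ := hcauchy.exists_norm_le
    exact absurd (h _ hcauchy.isWeaklyCompact_differenceSet).1
      ((hx.comp hφ).not_isRelativelySuperWeaklyCompact_differenceSet hδ hC)
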